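/- Let $\mathbb{D}\subset\mathbb{C}$ be the open unit disc, $\mathbb{T}$ the unit circle, and let $b\mathbb{D}^2$ denote the topological boundary of the bidisc $\mathbb{D}^2\subset\mathbb{C}^2$. The Bergman space $A^2(\mathbb{D}^2)$ is the space of all holomorphic functions $f:\mathbb{D}^2\to\mathbb{C}$ with $\|f\|^2=\int_{\mathbb{D}^2}|f|^2\,dV<\infty$, where $dV$ is Lebesgue measure, equipped with this norm. Let $\varphi=(\varphi_1,\varphi_2):\mathbb{D}^2\to\mathbb{D}^2$ be a holomorphic self-map such that $\varphi_1$ and $\varphi_2$ extend continuously to $\overline{\mathbb{D}^2}$ (the extension is again denoted by $\varphi$). Assume that $$\varphi(\overline{\mathbb{D}^2})\cap\mathbb{T}^2=\emptyset\qquad\text{and}\qquad \varphi(\overline{\mathbb{D}^2}\setminus\mathbb{T}^2)\cap b\mathbb{D}^2=\emptyset .$$ Then the composition operator $C_\varphi f=f\circ\varphi$ maps $A^2(\mathbb{D}^2)$ into itself and is a bounded, compact operator on $A^2(\mathbb{D}^2)$. -/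

import Mathlib

open MeasureTheory

noncomputable section

/-- The open unit bidisc in `ℂ × ℂ`. -/
def bidisc : Set (ℂ × ℂ) := Metric.ball (0 : ℂ) 1 ×ˢ Metric.ball (0 : ℂ) 1

/-- The torus, i.e. the product of two unit circles in `ℂ × ℂ`. -/
def torus : Set (ℂ × ℂ) := Metric.sphere (0 : ℂ) 1 ×ˢ Metric.sphere (0 : ℂ) 1

theorem isOpen_bidisc : IsOpen bidisc := Metric.isOpen_ball.prod Metric.isOpen_ball

/-- Lebesgue measure on the bidisc. -/
def bidiscMeasure : Measure bidisc := Measure.comap Subtype.val volume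

/-- A function on the bidisc is holomorphic if it is the restriction of a function that is
complex differentiable at every point of the (open) bidisc. -/
def HolomorphicOnBidisc (f : bidisc → ℂ) : Prop :=
  ∃ F : ℂ × ℂ → ℂ, DifferentiableOn ℂ F bidisc ∧ ∀ z : bidisc, f z = F z

theorem HolomorphicOnBidisc.continuous {f : bidisc → ℂ} (hf : HolomorphicOnBidisc f) :
    Continuous f := by
  obtain ⟨F, hF, h⟩ := hf
  have : f = bidisc.domRestrict F := funext h
  rw [this]
  exact continuousOn_iff_continuous_domRestrict.mp hF.continuousOn

/-- The holomorphic functions on the bidisc that are square integrable for Lebesgue measure,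
as a linear subspace of all functions on the bidisc. -/
def bergmanSubmodule : Submodule ℂ (bidisc → ℂ) where
  carrier := {f | HolomorphicOnBidisc f ∧ MemLp f 2 bidiscMeasure}
  zero_mem' := ⟨⟨0, differentiableOn_const 0, fun _ => rfl⟩, MemLp.zero⟩
  add_mem' := by
    rintro f g ⟨⟨F, hF, hfF⟩, hf⟩ ⟨⟨G, hG, hgG⟩, hg⟩
    exact ⟨⟨F + G, hF.add hG, fun z => by simp [hfF z, hgG z]⟩, hf.add hg⟩
  smul_mem' := by
    rintro c f ⟨⟨F, hF, hfF⟩, hf⟩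
    exact ⟨⟨c • F, hF.const_smul c, fun z => by simp [hfF z]⟩, hf.const_smul c⟩

/-- The Bergman space of the bidisc. It is a type of its own so that it carries the
`L²` norm and not the topology of pointwise convergence. -/
def BergmanSpace : Type := bergmanSubmodule

namespace BergmanSpace

instance : AddCommGroup BergmanSpace := inferInstanceAs (AddCommGroup bergmanSubmodule)

instance : Module ℂ BergmanSpace := inferInstanceAs (Module ℂ bergmanSubmodule)

instance : CoeFun BergmanSpace (fun _ => bidisc → ℂ) := ⟨fun f => f.1⟩

/-- The inclusion of the Bergman space in `L²` of the bidisc. -/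
def toL2 : BergmanSpace →ₗ[ℂ] Lp ℂ 2 bidiscMeasure where
  toFun f := f.2.2.toLp f.1
  map_add' _ _ := rfl
  map_smul' _ _ := rfl

theorem coeFn_toL2 (f : BergmanSpace) :
    (toL2 f : bidisc → ℂ) =ᵐ[bidiscMeasure] (f : bidisc → ℂ) :=
  f.2.2.coeFn_toLp

theorem toL2_injective : Function.Injective toL2 := by
  intro f g h
  have hae : (f : bidisc → ℂ) =ᵐ[bidiscMeasure] (g : bidisc → ℂ) :=
    (coeFn_toL2 f).symm.trans (h ▸ coeFn_toL2 g)
  have hpos : bidiscMeasure.IsOpenPosMeasure := by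
    refine ⟨fun U hU hne h0 => ?_⟩
    rw [bidiscMeasure, Measure.comap_apply _ Subtype.val_injective
      (fun s hs => isOpen_bidisc.measurableSet.subtype_image hs) _ hU.measurableSet] at h0
    exact (isOpen_bidisc.isOpenMap_subtype_val U hU).measure_ne_zero volume (hne.image _) h0
  exact Subtype.ext (Measure.eq_of_ae_eq hae f.2.1.continuous g.2.1.continuous)

/-- The norm of the Bergman space is the `L²` norm. -/
instance : NormedAddCommGroup BergmanSpace :=
  NormedAddCommGroup.induced BergmanSpace (Lp ℂ 2 bidiscMeasure) toL2 toL2_injective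

instance : NormedSpace ℂ BergmanSpace :=
  NormedSpace.induced ℂ BergmanSpace (Lp ℂ 2 bidiscMeasure) toL2

theorem norm_sq_eq (f : BergmanSpace) :
    ‖f‖ ^ 2 = ∫ z : ℂ × ℂ in bidisc, ‖Function.extend Subtype.val (f : bidisc → ℂ) 0 z‖ ^ 2 := by
  have h1 : ‖f‖ = ‖toL2 f‖ := rfl
  have h2 : ‖toL2 f‖ ^ 2 = ∫ z : bidisc, ‖toL2 f z‖ ^ 2 ∂bidiscMeasure := by
    have := MeasureTheory.L2.inner_def (𝕜 := ℂ) (toL2 f) (toL2 f)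
    rw [inner_self_eq_norm_sq_to_K] at this
    simp only [inner_self_eq_norm_sq_to_K] at this
    have h3 : ∀ z : bidisc, ((‖toL2 f z‖ : ℂ)) ^ 2 = ((‖toL2 f z‖ ^ 2 : ℝ) : ℂ) := by
      intro z; push_cast; rfl
    have h4 : ((‖toL2 f‖ ^ 2 : ℝ) : ℂ) = ((∫ z : bidisc, ‖toL2 f z‖ ^ 2 ∂bidiscMeasure : ℝ) : ℂ) := by
      rw [← integral_complex_ofReal]
      push_cast
      exact this
    exact_mod_cast h4
  rw [h1, h2, ← integral_subtype_comap isOpen_bidisc.measurableSet]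
  refine integral_congr_ae ?_
  filter_upwards [coeFn_toL2 f] with z hz
  rw [hz, Subtype.val_injective.extend_apply]

end BergmanSpace

/-- The composition operator `f ↦ f ∘ φ` on functions on the bidisc. -/
def compOp (φ : ℂ × ℂ → ℂ × ℂ) (hφ : Set.MapsTo φ bidisc bidisc) :
    (bidisc → ℂ) →ₗ[ℂ] (bidisc → ℂ) where
  toFun f := fun z => f ⟨φ z, hφ z.2⟩
  map_add' _ _ := rfl
  map_smul' _ _ := rfl

/-- The composition operator with symbol `φ` is compact on the Bergman space: it maps the
Bergman space to itself, and it is a bounded and compact operator there. -/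
def CompOpCompactOnBergmanSpace (φ : ℂ × ℂ → ℂ × ℂ) (hφ : Set.MapsTo φ bidisc bidisc) : Prop :=
  ∃ T : BergmanSpace →L[ℂ] BergmanSpace,
    (∀ f : BergmanSpace, (T f : bidisc → ℂ) = compOp φ hφ (f : bidisc → ℂ)) ∧
    IsCompactOperator T

end

/-! By compactness the smaller of the moduli of the two coordinates of `φ` stays below some `1 - ε`,
so only one coordinate can approach the unit circle at a time. Call it g, and the other p. Averaging
|F|² over a polydisc about φ(z), of radius ε in the p-variable and (1 - |g(z)|)/2 in the g-variable,
and exchanging integrals bounds the part of ∫|F ∘ φ|² near the boundary by ∫|F|² times a Carleson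
quotient: the volume of the z with g(z) near u₂, divided by (1 - |u₂|)².

This quotient is small because the set where g is within δ of a unimodular point has volume O(δ³),
not merely O(δ²) (`volume_near_unimodular_le`). The closed axes miss the torus, so `φ` sends them
into a compact part of the bidisc. Schwarz–Pick on slices then puts both |z₁| and |z₂| within O(δ)
of 1, and the mean value of a function with positive real part leaves angles of z₁ of measure O(δ).
The spare factor makes the contribution of |g| > 1 - η at most O(η)‖F‖².

The remaining points only see F on a smaller polydisc, where the unit ball of the Bergman space is
totally bounded in the uniform norm. So the image of the unit ball is totally bounded, and
completeness makes its closure compact. -/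

noncomputable section

open Metric Set Real ENNReal Filter Topology ComplexConjugate

/-! ### Sub-mean value inequalities in one variable -/

/-- The mean value property, with the circle parametrized by `(-π, π)`. -/
theorem setIntegral_circleMap_eq {F : ℂ → ℂ} {c : ℂ} {R ρ : ℝ} (hF : DifferentiableOn ℂ F (ball c R))
    (hρ : 0 ≤ ρ) (hρR : ρ < R) :
    ∫ θ in Ioo (-π) π, F (circleMap c ρ θ) = (2 * π) • F c := by
  have h1 : circleAverage F c ρ = F c := by
    apply DiffContOnCl.circleAverage
    rw [abs_of_nonneg hρ]
    exact hF.diffContOnCl_ball (closedBall_subset_ball hρR)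
  rw [Real.circleAverage_eq_integral_add (-π)] at h1
  have h2 : ∫ θ in (0 : ℝ)..2 * π, F (circleMap c ρ (θ + -π)) =
      ∫ θ in (-π)..π, F (circleMap c ρ θ) := by
    rw [intervalIntegral.integral_comp_add_right (fun θ => F (circleMap c ρ θ))]
    congr 1 <;> ring
  rw [← integral_Ioc_eq_integral_Ioo,
    ← intervalIntegral.integral_of_le (by linarith [pi_pos]), ← h2, ← h1, smul_smul,
    mul_inv_cancel₀ (by positivity), one_smul]

theorem lintegral_complex_polar (f : ℂ → ℝ≥0∞) :
    ∫⁻ z, f z = ∫⁻ p in Ioi (0 : ℝ) ×ˢ Ioo (-π) π, ENNReal.ofReal p.1 * f (circleMap 0 p.1 p.2) := by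
  rw [← Complex.lintegral_comp_polarCoord_symm]
  have h : ∀ p : ℝ × ℝ, Complex.polarCoord.symm p = circleMap 0 p.1 p.2 := by
    intro p
    rw [Complex.polarCoord_symm_apply, circleMap, Complex.exp_mul_I]
    push_cast; ring
  simp_rw [h, smul_eq_mul]
  rfl

theorem enorm_sq_le_lintegral_circleMap {F : ℂ → ℂ} {c : ℂ} {R ρ : ℝ}
    (hF : DifferentiableOn ℂ F (ball c R)) (hρ : 0 ≤ ρ) (hρR : ρ < R) :
    ENNReal.ofReal (2 * π) * ‖F c‖ₑ ^ 2 ≤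
      ∫⁻ θ in Ioo (-π) π, ‖F (circleMap c ρ θ)‖ₑ ^ 2 := by
  -- The mean value property is applied to the holomorphic function F², so no convexity argument is
  -- needed.
  have h := setIntegral_circleMap_eq (hF.pow 2) hρ hρR
  calc ENNReal.ofReal (2 * π) * ‖F c‖ₑ ^ 2 = ‖(2 * π) • (F c ^ 2)‖ₑ := by
        rw [enorm_smul, enorm_pow, Real.enorm_of_nonneg (by positivity)]
    _ ≤ ∫⁻ θ in Ioo (-π) π, ‖(F ^ 2) (circleMap c ρ θ)‖ₑ := by
        rw [← Pi.pow_apply, ← h]; exact enorm_integral_le_lintegral_enorm _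
    _ = _ := by simp only [Pi.pow_apply, enorm_pow]

theorem enorm_sq_le_lintegral_ball {F : ℂ → ℂ} (hm : Measurable F) {c : ℂ} {R : ℝ}
    (hF : DifferentiableOn ℂ F (ball c R)) (hR : 0 ≤ R) :
    ENNReal.ofReal (π * R ^ 2) * ‖F c‖ₑ ^ 2 ≤ ∫⁻ z in ball c R, ‖F z‖ₑ ^ 2 := by
  have hcm : Measurable fun p : ℝ × ℝ => circleMap c p.1 p.2 :=
    (circleMap.continuous (c := c)).measurable
  have h1 : ∫⁻ z in ball c R, ‖F z‖ₑ ^ 2 =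
      ∫⁻ ρ in Ioi (0 : ℝ), ∫⁻ θ in Ioo (-π) π, ENNReal.ofReal ρ *
        (ball c R).indicator (fun z => ‖F z‖ₑ ^ 2) (circleMap c ρ θ) := by
    rw [← lintegral_indicator measurableSet_ball,
      ← lintegral_add_left_eq_self _ c, lintegral_complex_polar, Measure.volume_eq_prod,
      ← Measure.prod_restrict]
    have h : ∀ p : ℝ × ℝ, c + circleMap 0 p.1 p.2 = circleMap c p.1 p.2 := by
      intro p; simp [circleMap]
    simp_rw [h]
    rw [lintegral_prod]
    have : Measurable ((ball c R).indicator fun z => ‖F z‖ₑ ^ 2) :=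
      (hm.enorm.pow_const 2).indicator measurableSet_ball
    exact ((measurable_fst.ennreal_ofReal).mul (this.comp hcm)).aemeasurable
  have h2 : ∫⁻ ρ in Ioo 0 R, ENNReal.ofReal ρ = ENNReal.ofReal (R ^ 2 / 2) := by
    rw [← ofReal_integral_eq_lintegral_ofReal]
    · rw [← integral_Ioc_eq_integral_Ioo, ← intervalIntegral.integral_of_le hR, integral_id]
      simp
    · exact (continuous_id.integrableOn_Icc (a := 0) (b := R)).mono_set Ioo_subset_Icc_self
    · filter_upwards [ae_restrict_mem measurableSet_Ioo] with x hx using hx.1.le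
  rw [h1]
  calc ENNReal.ofReal (π * R ^ 2) * ‖F c‖ₑ ^ 2
      = ∫⁻ ρ in Ioo 0 R, ENNReal.ofReal ρ * (ENNReal.ofReal (2 * π) * ‖F c‖ₑ ^ 2) := by
        rw [lintegral_mul_const _ (by fun_prop), h2, ← mul_assoc,
          ← ENNReal.ofReal_mul (by positivity)]
        congr 2; ring
    _ ≤ ∫⁻ ρ in Ioo 0 R, ∫⁻ θ in Ioo (-π) π, ENNReal.ofReal ρ *
        (ball c R).indicator (fun z => ‖F z‖ₑ ^ 2) (circleMap c ρ θ) := by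
        refine setLIntegral_mono' measurableSet_Ioo fun ρ hρ => ?_
        rw [lintegral_const_mul' _ _ ofReal_ne_top]
        gcongr
        refine (enorm_sq_le_lintegral_circleMap hF hρ.1.le hρ.2).trans (le_of_eq ?_)
        congr with θ
        rw [indicator_of_mem]
        simpa [circleMap, abs_of_pos hρ.1] using hρ.2
    _ ≤ _ := lintegral_mono_set Ioo_subset_Ioi_self

/-! ### Volume of the set where a holomorphic function is near a unimodular value -/

/-- A set of points of modulus in `[1 - t, 1)` whose circular slices have angular measure at most
`m` has area at most `t * m`. -/
theorem volume_le_of_circle_slices {S : Set ℂ} (hS : MeasurableSet S) {t : ℝ} {m : ℝ≥0∞}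
    (hle : ∀ z ∈ S, ‖z‖ < 1 ∧ 1 - ‖z‖ ≤ t)
    (hm : ∀ ρ : ℝ, 0 ≤ ρ → ρ < 1 → volume (Ioo (-π) π ∩ {θ | circleMap 0 ρ θ ∈ S}) ≤ m) :
    volume S ≤ ENNReal.ofReal t * m := by
  rw [← lintegral_indicator_one hS, lintegral_complex_polar, Measure.volume_eq_prod,
      ← Measure.prod_restrict]
  refine (lintegral_prod_le _).trans ?_
  have h1 : ∀ ρ ∈ Ioi (0 : ℝ), ∫⁻ θ in Ioo (-π) π, ENNReal.ofReal ρ *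
      S.indicator 1 (circleMap 0 ρ θ) ≤ (Ico (1 - t) 1).indicator (fun _ => m) ρ := by
    intro ρ (hρ : 0 < ρ)
    have hn : ∀ θ, ‖circleMap 0 ρ θ‖ = ρ := fun θ => by simp [abs_of_pos hρ]
    by_cases h : ρ ∈ Ico (1 - t) 1
    · rw [indicator_of_mem h, lintegral_const_mul' _ _ ofReal_ne_top]
      have h3 : ∫⁻ θ in Ioo (-π) π, S.indicator (1 : ℂ → ℝ≥0∞) (circleMap 0 ρ θ) ≤ m := by
        refine le_trans (le_of_eq ?_) (hm ρ hρ.le h.2)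
        have hmeas : MeasurableSet {θ | circleMap 0 ρ θ ∈ S} :=
          (continuous_circleMap 0 ρ).measurable hS
        rw [inter_comm, ← Measure.restrict_apply hmeas, ← lintegral_indicator_one hmeas]
        rfl
      calc _ ≤ 1 * m := by
            gcongr
            exact ENNReal.ofReal_le_one.2 h.2.le
        _ = m := one_mul m
    · rw [indicator_of_notMem h]
      have : ∀ θ, circleMap 0 ρ θ ∉ S := by
        intro θ hθ
        have := hle _ hθ
        rw [hn] at this
        exact h ⟨by linarith, this.1⟩
      simp [this]
  refine (setLIntegral_mono' measurableSet_Ioi h1).trans ?_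
  refine (setLIntegral_le_lintegral _ _).trans ?_
  rw [lintegral_indicator measurableSet_Ico, setLIntegral_const, Real.volume_Ico, mul_comm]
  simp

theorem norm_conj_mul_sub_one {ζ w : ℂ} (hζ : ‖ζ‖ = 1) : ‖conj ζ * w - 1‖ = ‖w - ζ‖ := by
  have h : conj ζ * ζ = 1 := by
    rw [mul_comm, Complex.mul_conj, Complex.normSq_eq_norm_sq, hζ]; simp
  calc ‖conj ζ * w - 1‖ = ‖conj ζ * (w - ζ)‖ := by rw [mul_sub, h]
    _ = ‖w - ζ‖ := by rw [norm_mul, RCLike.norm_conj, hζ, one_mul]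

/-- A quantitative form of the fact that a nonconstant function cannot take a fixed unimodular
value on a large set of points of a circle. -/
theorem volume_angle_le {h : ℂ → ℂ} (hd : DifferentiableOn ℂ h (ball 0 1))
    (hmap : MapsTo h (ball 0 1) (ball 0 1)) {r : ℝ} (hr : ‖h 0‖ ≤ r) (hr1 : r < 1)
    {ζ : ℂ} (hζ : ‖ζ‖ = 1) {δ : ℝ} (hδ : 0 < δ) {ρ : ℝ} (hρ : 0 ≤ ρ) (hρ1 : ρ < 1) :
    volume (Ioo (-π) π ∩ {θ | ‖h (circleMap 0 ρ θ) - ζ‖ < δ}) ≤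
      ENNReal.ofReal (4 * π * δ / (1 - r)) := by
  -- The shift by δ keeps Re w > δ on the disc, so 1/w is holomorphic with positive real part. Its
  -- mean over circles is controlled by w(0), which `r` keeps away from 0.
  set w : ℂ → ℂ := fun z => 1 + δ - conj ζ * h z with hw
  have hre : ∀ z, 1 - ‖h z‖ + δ ≤ (w z).re := by
    intro z
    have h1 : (conj ζ * h z).re ≤ ‖h z‖ := by
      refine (Complex.re_le_norm _).trans (le_of_eq ?_)
      rw [norm_mul, RCLike.norm_conj, hζ, one_mul]
    simp only [hw, Complex.sub_re, Complex.add_re, Complex.one_re, Complex.ofReal_re]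
    linarith
  have hpos : ∀ z ∈ ball (0 : ℂ) 1, 0 < (w z).re := fun z hz => by
    have := hre z
    have h2 := mem_ball_zero_iff.1 (hmap hz)
    linarith
  have hne : ∀ z ∈ ball (0 : ℂ) 1, w z ≠ 0 := fun z hz h0 => by
    have := hpos z hz
    rw [h0] at this
    simp at this
  have hG : DifferentiableOn ℂ (fun z => (w z)⁻¹) (ball 0 1) :=
    ((differentiableOn_const _).sub (hd.const_mul _)).inv hne
  have hcirc : ∀ θ, circleMap 0 ρ θ ∈ ball (0 : ℂ) 1 := fun θ => by
    simpa [abs_of_nonneg hρ] using hρ1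
  have hcont : Continuous fun θ => (w (circleMap 0 ρ θ))⁻¹ :=
    hG.continuousOn.comp_continuous (continuous_circleMap 0 ρ) hcirc
  have hint : IntegrableOn (fun θ => (w (circleMap 0 ρ θ))⁻¹) (Ioo (-π) π) :=
    hcont.integrableOn_Icc.mono_set Ioo_subset_Icc_self
  have hmean := setIntegral_circleMap_eq hG hρ hρ1
  have hmean' : ∫ θ in Ioo (-π) π, ((w (circleMap 0 ρ θ))⁻¹).re = 2 * π * ((w 0)⁻¹).re := by
    have := congrArg Complex.re hmean
    rw [← RCLike.re_eq_complex_re, ← integral_re hint] at this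
    simpa using this
  have h0 : ((w 0)⁻¹).re ≤ 1 / (1 - r) := by
    have hb : 1 - r ≤ ‖w 0‖ := by
      have := (hre 0).trans (Complex.re_le_norm _)
      linarith
    calc ((w 0)⁻¹).re ≤ ‖(w 0)⁻¹‖ := Complex.re_le_norm _
      _ = 1 / ‖w 0‖ := by rw [norm_inv, one_div]
      _ ≤ 1 / (1 - r) := one_div_le_one_div_of_le (by linarith) hb
  -- Here w lies in the disc |v - δ| < δ, which inversion maps onto the half-plane Re > 1/(2δ).
  -- Markov's inequality then bounds the set of such angles.
  have hsub : {θ | ‖h (circleMap 0 ρ θ) - ζ‖ < δ} ⊆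
      {θ | 1 / (2 * δ) ≤ ((w (circleMap 0 ρ θ))⁻¹).re} := by
    intro θ (hθ : ‖h (circleMap 0 ρ θ) - ζ‖ < δ)
    have hp := hpos _ (hcirc θ)
    set v := w (circleMap 0 ρ θ) with hv
    have h1 : ‖v - δ‖ < δ := by
      have h2 : v - δ = -(conj ζ * h (circleMap 0 ρ θ) - 1) := by rw [hv, hw]; ring
      rwa [h2, norm_neg, norm_conj_mul_sub_one hζ]
    have h2 : Complex.normSq (v - δ) < δ ^ 2 := by
      rw [Complex.normSq_eq_norm_sq]
      gcongr
    have h3 : 0 < Complex.normSq v := Complex.normSq_pos.2 (hne _ (hcirc θ))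
    simp only [mem_ofPred_eq, Complex.inv_re]
    rw [div_le_div_iff₀ (by positivity) h3]
    simp only [Complex.normSq_apply, Complex.sub_re, Complex.sub_im, Complex.ofReal_re,
      Complex.ofReal_im] at h2 ⊢
    nlinarith
  have hmarkov := mul_meas_ge_le_integral_of_nonneg (μ := volume.restrict (Ioo (-π) π))
    (f := fun θ => ((w (circleMap 0 ρ θ))⁻¹).re)
    (Filter.Eventually.of_forall fun θ => by
      simp only [Pi.zero_apply, Complex.inv_re]
      exact div_nonneg (hpos _ (hcirc θ)).le (Complex.normSq_nonneg _)) hint.re (1 / (2 * δ))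
  rw [hmean'] at hmarkov
  have hmS : MeasurableSet {θ | 1 / (2 * δ) ≤ ((w (circleMap 0 ρ θ))⁻¹).re} :=
    (isClosed_le continuous_const (Complex.continuous_re.comp hcont)).measurableSet
  refine (measure_mono (inter_subset_inter_right _ hsub)).trans ?_
  rw [inter_comm, ← Measure.restrict_apply hmS]
  rw [← ofReal_measureReal (measure_ne_top _ _)]
  refine ENNReal.ofReal_le_ofReal ?_
  have h4 := hmarkov.trans (mul_le_mul_of_nonneg_left h0 (by positivity))
  rw [div_mul_eq_mul_div, one_mul, div_le_iff₀ (by positivity)] at h4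
  refine h4.trans (le_of_eq ?_)
  field_simp
  norm_num

/-- A consequence of the Schwarz–Pick lemma. -/
theorem one_sub_norm_le_of_mapsTo_ball {h : ℂ → ℂ} (hd : DifferentiableOn ℂ h (ball 0 1))
    (hmap : MapsTo h (ball 0 1) (ball 0 1)) {r : ℝ} (hr : ‖h 0‖ ≤ r) (hr1 : r < 1) {z : ℂ}
    (hz : z ∈ ball (0 : ℂ) 1) : (1 - r) * (1 - ‖z‖) ≤ 4 * (1 - ‖h z‖) := by
  set a := h 0 with ha
  have ha1 : ‖a‖ < 1 := hr.trans_lt hr1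
  have hh : ∀ z ∈ ball (0 : ℂ) 1, ‖h z‖ < 1 := fun z hz => mem_ball_zero_iff.1 (hmap hz)
  have hlow : ∀ z ∈ ball (0 : ℂ) 1, 1 - ‖a‖ ≤ ‖1 - conj a * h z‖ := fun z hz => by
    have h1 := norm_sub_norm_le (1 : ℂ) (conj a * h z)
    rw [norm_one, norm_mul, RCLike.norm_conj] at h1
    nlinarith [hh z hz, norm_nonneg a, norm_nonneg (h z)]
  have hne : ∀ z ∈ ball (0 : ℂ) 1, 1 - conj a * h z ≠ 0 := fun z hz h0 => by
    have := hlow z hz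
    rw [h0, norm_zero] at this
    linarith
  -- The identity behind the invariance of the pseudo-hyperbolic distance; it lets the Schwarz lemma
  -- for k be rewritten in terms of 1 - |h|².
  have hid : ∀ z, ‖1 - conj a * h z‖ ^ 2 - ‖h z - a‖ ^ 2 = (1 - ‖a‖ ^ 2) * (1 - ‖h z‖ ^ 2) := by
    intro z
    simp only [← Complex.normSq_eq_norm_sq, Complex.normSq_apply, Complex.sub_re, Complex.sub_im,
      Complex.one_re, Complex.one_im, Complex.mul_re, Complex.mul_im, Complex.conj_re,
      Complex.conj_im]
    ring
  set k : ℂ → ℂ := fun z => (h z - a) / (1 - conj a * h z) with hk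
  have hkd : DifferentiableOn ℂ k (ball 0 1) :=
    (hd.sub_const a).div ((differentiableOn_const _).sub (hd.const_mul _)) hne
  have hkmap : MapsTo k (ball 0 1) (closedBall 0 1) := fun z hz => by
    rw [mem_closedBall_zero_iff, hk, norm_div]
    refine div_le_one_of_le₀ ?_ (norm_nonneg _)
    rw [← sq_le_sq₀ (norm_nonneg _) (norm_nonneg _)]
    have h1 : 0 ≤ (1 - ‖a‖ ^ 2) * (1 - ‖h z‖ ^ 2) :=
      mul_nonneg (by nlinarith [norm_nonneg a]) (by nlinarith [hh z hz, norm_nonneg (h z)])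
    linarith [hid z]
  have hk0 : k 0 = 0 := by simp [hk, ← ha]
  have hkz := Complex.norm_le_norm_of_mapsTo_ball hkd hkmap hk0 (mem_ball_zero_iff.1 hz)
  have hz1 := mem_ball_zero_iff.1 hz
  have hzz := hh z hz
  have hl := hlow z hz
  have hden : 0 < ‖1 - conj a * h z‖ := norm_pos_iff.2 (hne z hz)
  rw [hk, norm_div, div_le_iff₀ hden] at hkz
  have h1 : ‖h z - a‖ ^ 2 ≤ ‖z‖ ^ 2 * ‖1 - conj a * h z‖ ^ 2 := by
    rw [← mul_pow]; gcongr
  have h2 : (1 - ‖a‖) ^ 2 ≤ ‖1 - conj a * h z‖ ^ 2 := by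
    gcongr
  have h3 : (1 - ‖a‖) ^ 2 * (1 - ‖z‖ ^ 2) ≤ (1 - ‖a‖ ^ 2) * (1 - ‖h z‖ ^ 2) := by
    have h5 : 0 ≤ 1 - ‖z‖ ^ 2 := by nlinarith [norm_nonneg z]
    nlinarith [hid z, mul_le_mul_of_nonneg_right h2 h5]
  have h4 : (1 - ‖a‖) * (1 - ‖z‖ ^ 2) ≤ (1 + ‖a‖) * (1 - ‖h z‖ ^ 2) := by
    refine le_of_mul_le_mul_left ?_ (sub_pos.2 ha1)
    linarith
  have h5 : (1 - r) * (1 - ‖z‖) ≤ (1 - ‖a‖) * (1 - ‖z‖ ^ 2) := by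
    refine mul_le_mul (by linarith) (by nlinarith [norm_nonneg z]) (by linarith) (by linarith)
  have h6 : (1 + ‖a‖) * (1 - ‖h z‖ ^ 2) ≤ 2 * (2 * (1 - ‖h z‖)) := by
    refine mul_le_mul (by linarith) (by nlinarith [norm_nonneg (h z)])
      (by nlinarith [norm_nonneg (h z)]) (by norm_num)
  linarith

/-- Each of three directions contributes a factor of order δ: the modulus of z₁, the angle of z₁ and
the modulus of z₂. The bounds on the axes make the Schwarz–Pick constants uniform over all slices.
-/
theorem volume_near_unimodular_le {g : ℂ × ℂ → ℂ} (hg : Measurable g)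
    (hd : DifferentiableOn ℂ g bidisc) (hmap : MapsTo g bidisc (ball 0 1)) {r : ℝ} (hr1 : r < 1)
    (hr₁ : ∀ z ∈ ball (0 : ℂ) 1, ‖g (z, 0)‖ ≤ r) (hr₂ : ∀ z ∈ ball (0 : ℂ) 1, ‖g (0, z)‖ ≤ r)
    {ζ : ℂ} (hζ : ‖ζ‖ = 1) {δ : ℝ} (hδ : 0 < δ) :
    volume (bidisc ∩ {z | ‖g z - ζ‖ < δ}) ≤
      ENNReal.ofReal (128 * π ^ 2 * δ ^ 3 / (1 - r) ^ 3) := by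
  have h1r : 0 < 1 - r := by linarith
  have hS : MeasurableSet (bidisc ∩ {z | ‖g z - ζ‖ < δ}) :=
    isOpen_bidisc.measurableSet.inter (measurableSet_lt (by fun_prop) measurable_const)
  set t := 4 * δ / (1 - r) with ht
  set m : ℝ≥0∞ := ENNReal.ofReal t * ENNReal.ofReal (4 * π * δ / (1 - r)) with hm
  -- Near ζ one has 1 - |g| < δ, and Schwarz–Pick in each variable separately turns this into
  -- closeness of that variable to the circle.
  have key : ∀ z : ℂ × ℂ, z ∈ bidisc → ‖g z - ζ‖ < δ → 1 - ‖z.1‖ ≤ t ∧ 1 - ‖z.2‖ ≤ t := by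
    rintro ⟨z₁, z₂⟩ ⟨hz₁, hz₂⟩ hz
    simp only at hz₁ hz₂
    have h1 : 1 - ‖g (z₁, z₂)‖ < δ := by
      have := norm_sub_norm_le ζ (g (z₁, z₂))
      rw [norm_sub_rev, hζ] at this
      linarith
    have hs₁ := one_sub_norm_le_of_mapsTo_ball (h := fun z => g (z, z₂))
      (hd.comp (by fun_prop) fun z hz => ⟨hz, hz₂⟩) (fun z hz => hmap ⟨hz, hz₂⟩)
      (hr₂ _ hz₂) hr1 hz₁
    have hs₂ := one_sub_norm_le_of_mapsTo_ball (h := fun z => g (z₁, z))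
      (hd.comp (by fun_prop) fun z hz => ⟨hz₁, hz⟩) (fun z hz => hmap ⟨hz₁, hz⟩)
      (hr₁ _ hz₁) hr1 hz₂
    constructor <;> rw [ht, le_div_iff₀ h1r] <;> nlinarith
  have hslice : ∀ z₂ : ℂ, volume ((fun z₁ => (z₁, z₂)) ⁻¹' (bidisc ∩ {z | ‖g z - ζ‖ < δ})) ≤
      {z : ℂ | ‖z‖ < 1 ∧ 1 - ‖z‖ ≤ t}.indicator (fun _ => m) z₂ := by
    intro z₂
    by_cases hz₂ : z₂ ∈ {z : ℂ | ‖z‖ < 1 ∧ 1 - ‖z‖ ≤ t}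
    · rw [indicator_of_mem hz₂]
      have hb : z₂ ∈ ball (0 : ℂ) 1 := mem_ball_zero_iff.2 hz₂.1
      refine volume_le_of_circle_slices (measurable_prodMk_right hS)
        (fun z hz => ⟨mem_ball_zero_iff.1 hz.1.1, (key _ hz.1 hz.2).1⟩) fun ρ hρ hρ1 => ?_
      refine (measure_mono (inter_subset_inter_right _ fun θ hθ => ?_)).trans
        (volume_angle_le (h := fun z => g (z, z₂))
          (hd.comp (by fun_prop) fun z hz => ⟨hz, hb⟩) (fun z hz => hmap ⟨hz, hb⟩)
          (hr₂ _ hb) hr1 hζ hδ hρ hρ1)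
      exact hθ.2
    · rw [indicator_of_notMem hz₂]
      refine le_of_eq (measure_mono_null (t := ∅) (fun z hz => hz₂ ?_) measure_empty)
      exact ⟨mem_ball_zero_iff.1 hz.1.2, (key _ hz.1 hz.2).2⟩
  have hA : MeasurableSet {z : ℂ | ‖z‖ < 1 ∧ 1 - ‖z‖ ≤ t} :=
    (measurableSet_lt (f := fun z : ℂ => ‖z‖) (by fun_prop) measurable_const).inter
      (measurableSet_le (f := fun z : ℂ => 1 - ‖z‖) (by fun_prop) measurable_const)
  have hAv : volume {z : ℂ | ‖z‖ < 1 ∧ 1 - ‖z‖ ≤ t} ≤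
      ENNReal.ofReal t * ENNReal.ofReal (2 * π) := by
    refine volume_le_of_circle_slices hA (fun z hz => hz) fun ρ _ _ => ?_
    refine (measure_mono inter_subset_left).trans (le_of_eq ?_)
    rw [Real.volume_Ioo]
    congr 1; ring
  rw [Measure.volume_eq_prod, Measure.prod_apply_symm hS]
  refine (lintegral_mono hslice).trans ?_
  rw [lintegral_indicator hA, setLIntegral_const]
  refine (mul_le_mul_right hAv m).trans (le_of_eq ?_)
  have ht0 : 0 ≤ t := by positivity
  rw [hm, ← ENNReal.ofReal_mul ht0, ← ENNReal.ofReal_mul ht0,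
    ← ENNReal.ofReal_mul (by positivity)]
  congr 1
  rw [ht]
  field_simp
  norm_num

/-! ### Carleson-type estimate near the boundary -/

theorem enorm_sq_le_lintegral_polydisc {F : ℂ × ℂ → ℂ} (hm : Measurable F) {a b : ℂ} {s t : ℝ}
    (hF : DifferentiableOn ℂ F (ball a s ×ˢ ball b t)) (hs : 0 < s) (ht : 0 ≤ t) :
    ENNReal.ofReal (π * s ^ 2) * ENNReal.ofReal (π * t ^ 2) * ‖F (a, b)‖ₑ ^ 2 ≤
      ∫⁻ u in ball a s ×ˢ ball b t, ‖F u‖ₑ ^ 2 := by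
  calc _ = ENNReal.ofReal (π * s ^ 2) * (ENNReal.ofReal (π * t ^ 2) * ‖F (a, b)‖ₑ ^ 2) := mul_assoc ..
    _ ≤ ENNReal.ofReal (π * s ^ 2) * ∫⁻ y in ball b t, ‖F (a, y)‖ₑ ^ 2 := by
        gcongr
        exact enorm_sq_le_lintegral_ball (F := fun y => F (a, y)) (by fun_prop)
          (hF.comp (by fun_prop) fun y hy => ⟨mem_ball_self hs, hy⟩) ht
    _ = ∫⁻ y in ball b t, ENNReal.ofReal (π * s ^ 2) * ‖F (a, y)‖ₑ ^ 2 :=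
        (lintegral_const_mul' _ _ ofReal_ne_top).symm
    _ ≤ ∫⁻ y in ball b t, ∫⁻ x in ball a s, ‖F (x, y)‖ₑ ^ 2 := by
        refine setLIntegral_mono' measurableSet_ball fun y hy => ?_
        exact enorm_sq_le_lintegral_ball (F := fun x => F (x, y)) (by fun_prop)
          (hF.comp (by fun_prop) fun x hx => ⟨hx, hy⟩) hs.le
    _ = _ := by
        rw [Measure.volume_eq_prod, ← Measure.prod_restrict,
          lintegral_prod_symm _ (by fun_prop)]

/-- The volume is O((1 - |w|)³), so dividing by (1 - |w|)² leaves one factor 1 - |w|. This factor is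
O(η) whenever the set is nonempty, since 1 - |w| and 1 - |g| are comparable there. -/
theorem mul_volume_le_of_near {g : ℂ × ℂ → ℂ} (hg : Measurable g)
    (hd : DifferentiableOn ℂ g bidisc) (hmap : MapsTo g bidisc (ball 0 1)) {r : ℝ} (hr1 : r < 1)
    (hr₁ : ∀ z ∈ ball (0 : ℂ) 1, ‖g (z, 0)‖ ≤ r) (hr₂ : ∀ z ∈ ball (0 : ℂ) 1, ‖g (0, z)‖ ≤ r)
    {η : ℝ} {w : ℂ} (hw : ‖w‖ < 1) {M : ℝ} (hM : 0 ≤ M) :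
    ENNReal.ofReal (M / (1 - ‖w‖) ^ 2) *
      volume (bidisc ∩ {z | 1 - η < ‖g z‖ ∧ ‖w - g z‖ < (1 - ‖g z‖) / 2}) ≤
      ENNReal.ofReal (M * (1536 * π ^ 2 / (1 - r) ^ 3) * η) := by
  set h := 1 - ‖w‖ with hh
  have hpos : 0 < h := by linarith
  have hcomp : ∀ z, ‖w - g z‖ < (1 - ‖g z‖) / 2 →
      h ≤ 3 / 2 * (1 - ‖g z‖) ∧ (1 - ‖g z‖) / 2 < h := by
    intro z hz
    have h1 := norm_sub_norm_le w (g z)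
    have h2 := norm_sub_norm_le (g z) w
    rw [norm_sub_rev] at h2
    constructor <;> linarith
  by_cases hη : h < 3 / 2 * η
  -- ζ is the radial projection of w to the circle, or 1 if w = 0. Then |g - ζ| < 2h by the triangle
  -- inequality.
  · obtain ⟨ζ, hζ, hζw⟩ : ∃ ζ : ℂ, ‖ζ‖ = 1 ∧ ‖w - ζ‖ = h := by
      by_cases hw0 : w = 0
      · exact ⟨1, by simp, by simp [hw0, hh]⟩
      · have hn : ‖w‖ ≠ 0 := norm_ne_zero_iff.2 hw0
        refine ⟨(‖w‖ : ℂ)⁻¹ * w, by simp [hn], ?_⟩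
        have h1 : w - (‖w‖ : ℂ)⁻¹ * w = ((1 - ‖w‖⁻¹ : ℝ) : ℂ) * w := by push_cast; ring
        have h2 : 1 - ‖w‖⁻¹ ≤ 0 := by
          have := (one_le_inv₀ (norm_pos_iff.2 hw0)).2 hw.le
          linarith
        rw [h1, norm_mul, Complex.norm_real, Real.norm_of_nonpos h2, hh]
        field_simp
        ring
    have hv := volume_near_unimodular_le hg hd hmap hr1 hr₁ hr₂ hζ (δ := 2 * h) (by positivity)
    have hsub : bidisc ∩ {z | 1 - η < ‖g z‖ ∧ ‖w - g z‖ < (1 - ‖g z‖) / 2} ⊆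
        bidisc ∩ {z | ‖g z - ζ‖ < 2 * h} := by
      rintro z ⟨hz, -, hz2⟩
      refine ⟨hz, ?_⟩
      have h1 := norm_sub_le_norm_sub_add_norm_sub (g z) w ζ
      rw [norm_sub_rev (g z) w] at h1
      have := (hcomp z hz2).2
      show ‖g z - ζ‖ < 2 * h
      linarith
    have h1r : 0 < 1 - r := by linarith
    calc _ ≤ ENNReal.ofReal (M / h ^ 2) *
          ENNReal.ofReal (128 * π ^ 2 * (2 * h) ^ 3 / (1 - r) ^ 3) := by
          gcongr
          exact (measure_mono hsub).trans hv
      _ = ENNReal.ofReal (M * (1024 * π ^ 2 / (1 - r) ^ 3) * h) := by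
          rw [← ENNReal.ofReal_mul (by positivity)]
          congr 1
          field_simp
          ring
      _ ≤ ENNReal.ofReal (M * (1024 * π ^ 2 / (1 - r) ^ 3) * (3 / 2 * η)) := by gcongr
      _ = _ := by congr 1; ring
  · have : bidisc ∩ {z | 1 - η < ‖g z‖ ∧ ‖w - g z‖ < (1 - ‖g z‖) / 2} = ∅ := by
      rw [eq_empty_iff_forall_notMem]
      rintro z ⟨-, hz1, hz2⟩
      have := (hcomp z hz2).1
      linarith
    simp [this]

/-- The part of `F ∘ (p, g)` over the points where `g` is close to the unit circle is small
compared with `F`. -/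
theorem lintegral_comp_near_circle_le {p g F : ℂ × ℂ → ℂ} (hp : Measurable p) (hg : Measurable g)
    (hF : Measurable F) (hd : DifferentiableOn ℂ g bidisc) (hmap : MapsTo g bidisc (ball 0 1))
    (hFd : DifferentiableOn ℂ F bidisc) {r : ℝ} (hr1 : r < 1)
    (hr₁ : ∀ z ∈ ball (0 : ℂ) 1, ‖g (z, 0)‖ ≤ r) (hr₂ : ∀ z ∈ ball (0 : ℂ) 1, ‖g (0, z)‖ ≤ r)
    {ε η : ℝ} (hε : 0 < ε) :
    ∫⁻ z in bidisc ∩ {z | ‖p z‖ ≤ 1 - ε ∧ 1 - η < ‖g z‖}, ‖F (p z, g z)‖ₑ ^ 2 ≤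
      ENNReal.ofReal (13824 / (ε ^ 2 * (1 - r) ^ 3) * η) * ∫⁻ u in bidisc, ‖F u‖ₑ ^ 2 := by
  set A := bidisc ∩ {z | ‖p z‖ ≤ 1 - ε ∧ 1 - η < ‖g z‖} with hA
  have hAm : MeasurableSet A := isOpen_bidisc.measurableSet.inter
    ((measurableSet_le (f := fun z => ‖p z‖) (by fun_prop) measurable_const).inter
      (measurableSet_lt (f := fun _ => 1 - η) (g := fun z => ‖g z‖) measurable_const (by fun_prop)))
  set S : Set ((ℂ × ℂ) × (ℂ × ℂ)) := {q | ‖q.2.2 - g q.1‖ < (1 - ‖g q.1‖) / 2} with hS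
  have hSm : MeasurableSet S := measurableSet_lt (by fun_prop) (by fun_prop)
  -- The sub-mean value constant is 1/(π² ε² t²), and t ≥ (1 - |u₂|)/3 on the polydisc used; this
  -- gives the 9. The final constant is 13824 = 9 · 1536.
  set M := 9 / (π ^ 2 * ε ^ 2) with hM
  set c : ℂ × ℂ → ℝ≥0∞ := fun u => ENNReal.ofReal (M / (1 - ‖u.2‖) ^ 2) with hc
  have hcm : Measurable c := by fun_prop
  set k : (ℂ × ℂ) × (ℂ × ℂ) → ℝ≥0∞ := S.indicator fun q => c q.2 * ‖F q.2‖ₑ ^ 2 with hk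
  have hkm : Measurable k := ((hcm.comp measurable_snd).mul
    ((hF.comp measurable_snd).enorm.pow_const 2)).indicator hSm
  -- The sub-mean value property over a polydisc about (p z, g z), with the constant absorbed in the
  -- kernel k, whose weight depends on u alone so that the integrals can be exchanged.
  have hpt : ∀ z ∈ A, ‖F (p z, g z)‖ₑ ^ 2 ≤ ∫⁻ u in bidisc, k (z, u) := by
    rintro z ⟨hz, hpz, hgz⟩
    have hg1 : ‖g z‖ < 1 := mem_ball_zero_iff.1 (hmap hz)
    set t := (1 - ‖g z‖) / 2 with ht
    have ht0 : 0 < t := by linarith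
    have hsub : ball (p z) ε ×ˢ ball (g z) t ⊆ bidisc := by
      refine prod_mono (ball_subset_ball' ?_) (ball_subset_ball' ?_) <;> rw [dist_zero_right] <;>
        linarith
    have hmean := enorm_sq_le_lintegral_polydisc hF (hFd.mono hsub) hε ht0.le
    set e := ENNReal.ofReal (π * ε ^ 2) * ENNReal.ofReal (π * t ^ 2) with he
    have he' : e = ENNReal.ofReal (π * ε ^ 2 * (π * t ^ 2)) :=
      (ENNReal.ofReal_mul (by positivity)).symm
    have he0 : e ≠ 0 := by rw [he']; positivity
    have het : e ≠ ∞ := by rw [he']; exact ofReal_ne_top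
    calc ‖F (p z, g z)‖ₑ ^ 2 = e⁻¹ * (e * ‖F (p z, g z)‖ₑ ^ 2) := by
          rw [← mul_assoc, ENNReal.inv_mul_cancel he0 het, one_mul]
      _ ≤ e⁻¹ * ∫⁻ u in ball (p z) ε ×ˢ ball (g z) t, ‖F u‖ₑ ^ 2 := by gcongr
      _ = ∫⁻ u in ball (p z) ε ×ˢ ball (g z) t, e⁻¹ * ‖F u‖ₑ ^ 2 :=
          (lintegral_const_mul' _ _ (ENNReal.inv_ne_top.2 he0)).symm
      _ ≤ ∫⁻ u in ball (p z) ε ×ˢ ball (g z) t, k (z, u) := by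
          refine setLIntegral_mono' (measurableSet_ball.prod measurableSet_ball) fun u hu => ?_
          have hu2 : ‖u.2 - g z‖ < t := by simpa [dist_eq_norm] using hu.2
          rw [hk, indicator_of_mem (show (z, u) ∈ S from hu2)]
          gcongr
          have hu1 : ‖u.2‖ < 1 := mem_ball_zero_iff.1 (hsub hu).2
          have h3 : (1 - ‖u.2‖) / 3 ≤ t := by
            have := norm_sub_norm_le (g z) u.2
            rw [norm_sub_rev] at this
            linarith
          rw [he', ← ENNReal.ofReal_inv_of_pos (by positivity), hc]
          refine ENNReal.ofReal_le_ofReal ?_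
          rw [hM, div_div, ← one_div, div_le_div_iff₀ (by positivity)
            (mul_pos (by positivity) (pow_pos (by linarith) 2))]
          have h4 : ((1 - ‖u.2‖) / 3) ^ 2 ≤ t ^ 2 := by gcongr
          have h5 : 0 ≤ π ^ 2 * ε ^ 2 := by positivity
          nlinarith [mul_le_mul_of_nonneg_left h4 h5]
      _ ≤ ∫⁻ u in bidisc, k (z, u) := lintegral_mono_set hsub
  have h0 := fun u : ℂ × ℂ => measurable_prodMk_right (y := u) hSm
  calc _ ≤ ∫⁻ z in A, ∫⁻ u in bidisc, k (z, u) := setLIntegral_mono' hAm hpt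
    _ = ∫⁻ u in bidisc, ∫⁻ z in A, k (z, u) := lintegral_lintegral_swap hkm.aemeasurable
    _ ≤ ∫⁻ u in bidisc, ENNReal.ofReal (13824 / (ε ^ 2 * (1 - r) ^ 3) * η) * ‖F u‖ₑ ^ 2 := by
        refine setLIntegral_mono' isOpen_bidisc.measurableSet fun u hu => ?_
        have h1 : ∫⁻ z in A, k (z, u) =
            c u * ‖F u‖ₑ ^ 2 * volume ((fun z => (z, u)) ⁻¹' S ∩ A) := by
          rw [← Measure.restrict_apply (h0 u), ← lintegral_indicator_const (h0 u)]
          rfl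
        rw [h1, mul_right_comm]
        gcongr
        have hsub : (fun z => (z, u)) ⁻¹' S ∩ A ⊆
            bidisc ∩ {z | 1 - η < ‖g z‖ ∧ ‖u.2 - g z‖ < (1 - ‖g z‖) / 2} :=
          fun z hz => ⟨hz.2.1, hz.2.2.2, hz.1⟩
        have h1r : 0 < 1 - r := by linarith
        calc _ ≤ _ := mul_le_mul_right (measure_mono hsub) _
          _ ≤ _ := mul_volume_le_of_near hg hd hmap hr1 hr₁ hr₂ (mem_ball_zero_iff.1 hu.2)
            (by positivity)
          _ = _ := by
            congr 1
            rw [hM]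
            field_simp
            ring
    _ = _ := lintegral_const_mul' _ _ ofReal_ne_top

/-! ### Pointwise bounds and completeness of the Bergman space -/

theorem bidisc_eq_ball : bidisc = ball (0 : ℂ × ℂ) 1 := ball_prod_same 0 0 1

namespace BergmanSpace

/-- The extension by zero of an element of the Bergman space. -/
def zeroExtension (f : BergmanSpace) : ℂ × ℂ → ℂ :=
  Function.extend Subtype.val (f : bidisc → ℂ) 0

theorem zeroExtension_apply (f : BergmanSpace) (z : bidisc) : zeroExtension f z = f.1 z :=
  Subtype.val_injective.extend_apply _ _ _

theorem zeroExtension_of_notMem (f : BergmanSpace) {z : ℂ × ℂ} (hz : z ∉ bidisc) :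
    zeroExtension f z = 0 :=
  Function.extend_apply' _ _ _ (by simpa using hz)

theorem zeroExtension_sub (f g : BergmanSpace) :
    zeroExtension (f - g) = zeroExtension f - zeroExtension g := by
  funext z
  by_cases hz : z ∈ bidisc
  · exact (zeroExtension_apply (f - g) ⟨z, hz⟩).trans
      (congrArg₂ (· - ·) (zeroExtension_apply f ⟨z, hz⟩) (zeroExtension_apply g ⟨z, hz⟩)).symm
  · simp [zeroExtension_of_notMem _ hz]

theorem differentiableOn_zeroExtension (f : BergmanSpace) :
    DifferentiableOn ℂ (zeroExtension f) bidisc := by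
  obtain ⟨F, hF, h⟩ := f.2.1
  exact hF.congr fun z hz => (zeroExtension_apply f ⟨z, hz⟩).trans (h ⟨z, hz⟩)

theorem differentiableAt_zeroExtension (f : BergmanSpace) {z : ℂ × ℂ} (hz : z ∈ bidisc) :
    DifferentiableAt ℂ (zeroExtension f) z :=
  (differentiableOn_zeroExtension f).differentiableAt (isOpen_bidisc.mem_nhds hz)

theorem measurable_zeroExtension (f : BergmanSpace) : Measurable (zeroExtension f) :=
  (MeasurableEmbedding.subtype_coe isOpen_bidisc.measurableSet).measurable_extend
    f.2.1.continuous.measurable measurable_const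

theorem eLpNorm_sq_eq_lintegral (F : ℂ × ℂ → ℂ) :
    eLpNorm (fun z : bidisc => F z) 2 bidiscMeasure ^ 2 = ∫⁻ z in bidisc, ‖F z‖ₑ ^ 2 := by
  have h := eLpNorm_nnreal_pow_eq_lintegral (f := fun z : bidisc => F z) (μ := bidiscMeasure)
    (p := 2) (by norm_num)
  have h2 : ∫⁻ z : bidisc, ‖F z‖ₑ ^ 2 ∂bidiscMeasure = ∫⁻ z in bidisc, ‖F z‖ₑ ^ 2 :=
    lintegral_subtype_comap isOpen_bidisc.measurableSet (fun z => ‖F z‖ₑ ^ 2)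
  rw [← h2]
  simpa using h

theorem enorm_sq_eq (f : BergmanSpace) : ‖f‖ₑ ^ 2 = ∫⁻ z in bidisc, ‖zeroExtension f z‖ₑ ^ 2 := by
  rw [← eLpNorm_sq_eq_lintegral]
  have h1 : ‖f‖ₑ = ‖toL2 f‖ₑ := rfl
  have h2 : ‖toL2 f‖ₑ = eLpNorm f.1 2 bidiscMeasure := Lp.enorm_toLp f.2.2
  rw [h1, h2]
  congr 2
  exact funext fun z => (zeroExtension_apply f z).symm

theorem norm_zeroExtension_le (f : BergmanSpace) {s : ℝ} (hs : s < 1) {z : ℂ × ℂ} (hz : ‖z‖ ≤ s) :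
    ‖zeroExtension f z‖ ≤ (π * (1 - s) ^ 2)⁻¹ * ‖f‖ := by
  have hs0 : 0 < 1 - s := by linarith
  have hsub : ball z.1 (1 - s) ×ˢ ball z.2 (1 - s) ⊆ bidisc := by
    refine prod_mono (ball_subset_ball' ?_) (ball_subset_ball' ?_) <;> rw [dist_zero_right]
    · linarith [norm_fst_le z]
    · linarith [norm_snd_le z]
  have h := (enorm_sq_le_lintegral_polydisc (measurable_zeroExtension f)
    ((differentiableOn_zeroExtension f).mono hsub) hs0 hs0.le).trans (lintegral_mono_set hsub)
  rw [← enorm_sq_eq, ← ENNReal.ofReal_mul (by positivity), ← ofReal_norm, ← ofReal_norm,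
    ← ENNReal.ofReal_pow (norm_nonneg _), ← ENNReal.ofReal_pow (norm_nonneg _),
    ← ENNReal.ofReal_mul (by positivity), ENNReal.ofReal_le_ofReal_iff (by positivity)] at h
  rw [inv_mul_eq_div, le_div_iff₀ (by positivity)]
  refine (sq_le_sq₀ (by positivity) (norm_nonneg _)).1 ?_
  rw [mul_pow]
  linarith

/-- The derivatives of the functions in the Bergman space are bounded on smaller polydiscs. -/
theorem exists_norm_fderiv_le {s : ℝ} (hs : s < 1) : ∃ D, 0 ≤ D ∧ ∀ (f : BergmanSpace) (z : ℂ × ℂ),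
    ‖z‖ ≤ s → ‖fderiv ℂ (zeroExtension f) z‖ ≤ D * ‖f‖ := by
  -- A ball of radius R about a point of norm at most s stays in the polydisc of radius (1 + s)/2,
  -- on which C bounds the functions; the Cauchy estimate applies there.
  set R := (1 - s) / 2 with hR
  set C := (π * (1 - (1 + s) / 2) ^ 2)⁻¹ with hC
  have hR0 : 0 < R := by linarith
  refine ⟨2 * C / R, by positivity, fun f z hz => ?_⟩
  have hb : ∀ w ∈ ball z R, ‖zeroExtension f w‖ ≤ C * ‖f‖ := fun w hw => by
    refine norm_zeroExtension_le f (by linarith) ?_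
    have := norm_le_norm_add_norm_sub z w
    rw [mem_ball_iff_norm'] at hw
    linarith
  have hsub : ball z R ⊆ bidisc := by
    rw [bidisc_eq_ball]
    refine ball_subset_ball' ?_
    rw [dist_zero_right]
    linarith
  have hmaps : MapsTo (zeroExtension f) (ball z R)
      (closedBall (zeroExtension f z) (2 * C * ‖f‖)) := fun w hw => by
    rw [mem_closedBall_iff_norm]
    have := norm_sub_le (zeroExtension f w) (zeroExtension f z)
    linarith [hb w hw, hb z (mem_ball_self hR0)]
  refine (Complex.norm_fderiv_le_div_of_mapsTo_ball
    ((differentiableOn_zeroExtension f).mono hsub) hmaps hR0).trans (le_of_eq ?_)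
  ring

theorem exists_lipschitz_bound {s : ℝ} (hs : s < 1) : ∃ D, 0 ≤ D ∧ ∀ (f : BergmanSpace)
    (z w : ℂ × ℂ), ‖z‖ ≤ s → ‖w‖ ≤ s →
      ‖zeroExtension f w - zeroExtension f z‖ ≤ D * ‖f‖ * ‖w - z‖ := by
  obtain ⟨D, hD, h⟩ := exists_norm_fderiv_le hs
  refine ⟨D, hD, fun f z w hz hw => ?_⟩
  refine (convex_closedBall (0 : ℂ × ℂ) s).norm_image_sub_le_of_norm_fderiv_le
    (fun x hx => differentiableAt_zeroExtension f ?_)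
    (fun x hx => h f x (mem_closedBall_zero_iff.1 hx)) (mem_closedBall_zero_iff.2 hz)
    (mem_closedBall_zero_iff.2 hw)
  rw [bidisc_eq_ball]
  exact closedBall_subset_ball hs hx

theorem isometry_toL2 : Isometry toL2 := by
  refine AddMonoidHomClass.isometry_of_norm toL2 fun f => rfl

/-- Norm-Cauchy sequences converge pointwise, and their derivatives converge locally uniformly, so
the pointwise limit is holomorphic. It agrees almost everywhere with the L² limit. -/
instance : CompleteSpace BergmanSpace := by
  refine Metric.complete_of_cauchySeq_tendsto fun f hf => ?_
  have hsmall : ∀ c > 0, ∃ N, ∀ m ≥ N, ∀ n ≥ N, ‖f m - f n‖ < c := by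
    intro c hc
    obtain ⟨N, hN⟩ := Metric.cauchySeq_iff.1 hf c hc
    exact ⟨N, fun m hm n hn => by simpa [dist_eq_norm] using hN m hm n hn⟩
  have hscale : ∀ D : ℝ, 0 ≤ D → ∀ c > 0, ∃ N, ∀ m ≥ N, ∀ n ≥ N, D * ‖f m - f n‖ < c := by
    intro D hD c hc
    obtain ⟨N, hN⟩ := hsmall (c / (D + 1)) (by positivity)
    refine ⟨N, fun m hm n hn => ?_⟩
    have := hN m hm n hn
    rw [lt_div_iff₀ (by positivity)] at this
    nlinarith [norm_nonneg (f m - f n)]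
  have hlim : ∀ z : ℂ × ℂ, ∃ a, Tendsto (fun n => zeroExtension (f n) z) atTop (𝓝 a) := by
    intro z
    by_cases hz : z ∈ bidisc
    · refine cauchySeq_tendsto_of_complete (Metric.cauchySeq_iff.2 fun c hc => ?_)
      rw [bidisc_eq_ball, mem_ball_zero_iff] at hz
      obtain ⟨N, hN⟩ := hscale (π * (1 - ‖z‖) ^ 2)⁻¹ (by positivity) c hc
      refine ⟨N, fun m hm n hn => ?_⟩
      rw [dist_eq_norm, ← Pi.sub_apply, ← zeroExtension_sub]
      exact (norm_zeroExtension_le _ hz le_rfl).trans_lt (hN m hm n hn)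
    · exact ⟨0, by simp [zeroExtension_of_notMem _ hz]⟩
  have hlim' : ∀ s < 1, UniformCauchySeqOn (fun n => fderiv ℂ (zeroExtension (f n))) atTop
      (closedBall (0 : ℂ × ℂ) s) := by
    intro s hs
    obtain ⟨D, hD, h⟩ := exists_norm_fderiv_le hs
    refine Metric.uniformCauchySeqOn_iff.2 fun c hc => ?_
    obtain ⟨N, hN⟩ := hscale D hD c hc
    refine ⟨N, fun m hm n hn z hz => lt_of_le_of_lt ?_ (hN m hm n hn)⟩
    have hzb : z ∈ bidisc := by
      rw [bidisc_eq_ball]; exact closedBall_subset_ball hs hz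
    rw [dist_eq_norm, ← fderiv_sub (differentiableAt_zeroExtension _ hzb)
      (differentiableAt_zeroExtension _ hzb), ← zeroExtension_sub]
    exact h _ z (mem_closedBall_zero_iff.1 hz)
  have hlim'' : ∀ z : ℂ × ℂ, ∃ L, z ∈ bidisc →
      Tendsto (fun n => fderiv ℂ (zeroExtension (f n)) z) atTop (𝓝 L) := by
    intro z
    by_cases hz : z ∈ bidisc
    · rw [bidisc_eq_ball, mem_ball_zero_iff] at hz
      obtain ⟨L, hL⟩ := cauchySeq_tendsto_of_complete
        ((hlim' _ hz).cauchySeq (mem_closedBall_zero_iff.2 le_rfl))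
      exact ⟨L, fun _ => hL⟩
    · exact ⟨0, fun h => absurd h hz⟩
  choose G hG using hlim
  choose G' hG' using hlim''
  have hloc : TendstoLocallyUniformlyOn (fun n => fderiv ℂ (zeroExtension (f n))) G' atTop
      bidisc := by
    refine tendstoLocallyUniformlyOn_of_forall_exists_nhds fun z hz => ?_
    have hz1 := hz
    rw [bidisc_eq_ball, mem_ball_zero_iff] at hz1
    have hs : (1 + ‖z‖) / 2 < 1 := by linarith
    refine ⟨closedBall 0 ((1 + ‖z‖) / 2), mem_nhdsWithin_of_mem_nhds
      (mem_of_superset (isOpen_ball.mem_nhds ?_) ball_subset_closedBall),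
      (hlim' _ hs).tendstoUniformlyOn_of_tendsto fun w hw => hG' w ?_⟩
    · rw [mem_ball_zero_iff]; linarith
    · rw [bidisc_eq_ball]; exact closedBall_subset_ball hs hw
  have hGd : DifferentiableOn ℂ G bidisc := fun z hz =>
    (hasFDerivAt_of_tendstoLocallyUniformlyOn isOpen_bidisc hloc
      (fun n w hw => (differentiableAt_zeroExtension (f n) hw).hasFDerivAt)
      (fun w _ => hG w) hz).differentiableAt.differentiableWithinAt
  obtain ⟨h, hh⟩ := cauchySeq_tendsto_of_complete (isometry_toL2.uniformContinuous.comp_cauchySeq hf)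
  -- L² convergence gives almost everywhere convergence only along a subsequence, which suffices to
  -- identify the two limits.
  have hae : (h : bidisc → ℂ) =ᵐ[bidiscMeasure] fun z => G z := by
    obtain ⟨ns, hns, hconv⟩ := (tendstoInMeasure_of_tendsto_Lp hh).exists_seq_tendsto_ae
    have hall : ∀ᵐ z ∂bidiscMeasure, ∀ n, toL2 (f n) z = (f n).1 z :=
      ae_all_iff.2 fun n => coeFn_toL2 (f n)
    filter_upwards [hconv, hall] with z hz1 hz2
    refine tendsto_nhds_unique hz1 ?_
    have := (hG z).comp hns.tendsto_atTop
    simpa [Function.comp_def, hz2, zeroExtension_apply] using this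
  let g : BergmanSpace := ⟨fun z => G z, ⟨G, hGd, fun _ => rfl⟩, (Lp.memLp h).ae_eq hae⟩
  have hg : toL2 g = h := Lp.ext ((coeFn_toL2 g).trans hae.symm)
  refine ⟨g, isometry_toL2.isEmbedding.tendsto_nhds_iff.2 ?_⟩
  rw [hg]
  exact hh

end BergmanSpace

/-! ### Uniform bounds on the symbol from compactness -/

theorem closure_bidisc : closure bidisc = closedBall (0 : ℂ) 1 ×ˢ closedBall (0 : ℂ) 1 := by
  rw [bidisc, closure_prod_eq, closure_ball _ one_ne_zero]

theorem isCompact_closure_bidisc : IsCompact (closure bidisc) := by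
  rw [closure_bidisc]
  exact (isCompact_closedBall _ _).prod (isCompact_closedBall _ _)

theorem preimage_swap_bidisc : Prod.swap ⁻¹' bidisc = bidisc := preimage_swap_prod _ _

theorem volume_bidisc_ne_top : volume bidisc ≠ ∞ :=
  measure_ne_top_of_subset subset_closure isCompact_closure_bidisc.measure_ne_top

theorem exists_min_norm_le {φ : ℂ × ℂ → ℂ × ℂ} (hφ : ContinuousOn φ (closure bidisc))
    (hmaps : MapsTo φ (closure bidisc) (closure bidisc))
    (htorus : φ '' closure bidisc ∩ torus = ∅) :
    ∃ ε > 0, ∀ z ∈ closure bidisc, min ‖(φ z).1‖ ‖(φ z).2‖ ≤ 1 - ε := by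
  obtain ⟨z₀, hz₀, hmax⟩ := isCompact_closure_bidisc.exists_isMaxOn
    (f := fun z => min ‖(φ z).1‖ ‖(φ z).2‖) ⟨0, subset_closure (by simp [bidisc])⟩
    (by fun_prop)
  refine ⟨1 - min ‖(φ z₀).1‖ ‖(φ z₀).2‖, ?_, fun z hz => by simpa using hmax hz⟩
  have h := hmaps hz₀
  rw [closure_bidisc, mem_prod, mem_closedBall_zero_iff, mem_closedBall_zero_iff] at h
  by_contra! hcon
  have h1 : 1 ≤ min ‖(φ z₀).1‖ ‖(φ z₀).2‖ := by linarith
  rw [le_min_iff] at h1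
  refine (eq_empty_iff_forall_notMem.1 htorus) (φ z₀) ⟨mem_image_of_mem _ hz₀, ?_, ?_⟩
  · exact mem_sphere_zero_iff_norm.2 (le_antisymm h.1 h1.1)
  · exact mem_sphere_zero_iff_norm.2 (le_antisymm h.2 h1.2)

theorem exists_norm_le_on_axes {φ : ℂ × ℂ → ℂ × ℂ} (hφ : ContinuousOn φ (closure bidisc))
    (hmaps : MapsTo φ (closure bidisc \ torus) bidisc) :
    ∃ r < 1, ∀ z ∈ ball (0 : ℂ) 1, ‖φ (z, 0)‖ ≤ r ∧ ‖φ (0, z)‖ ≤ r := by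
  set K : Set (ℂ × ℂ) := closedBall (0 : ℂ) 1 ×ˢ {0} ∪ {0} ×ˢ closedBall (0 : ℂ) 1 with hK
  have hKc : IsCompact K := ((isCompact_closedBall _ _).prod isCompact_singleton).union
    (isCompact_singleton.prod (isCompact_closedBall _ _))
  have hKsub : K ⊆ closure bidisc \ torus := by
    rintro ⟨a, b⟩ (⟨ha, rfl⟩ | ⟨rfl, ha⟩) <;> simp only [mem_closedBall_zero_iff] at ha <;>
      simp [closure_bidisc, torus, ha]
  obtain ⟨z₀, hz₀, hmax⟩ := hKc.exists_isMaxOn (f := fun z => ‖φ z‖) ⟨0, by simp [hK]⟩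
    (hφ.mono (hKsub.trans sdiff_subset)).norm
  refine ⟨‖φ z₀‖, ?_, fun z hz => ⟨hmax (Or.inl ⟨ball_subset_closedBall hz, rfl⟩),
    hmax (Or.inr ⟨rfl, ball_subset_closedBall hz⟩)⟩⟩
  have := hmaps (hKsub hz₀)
  rwa [bidisc_eq_ball, mem_ball_zero_iff] at this

/-! ### Norm estimate for the composition and compactness -/

namespace BergmanSpace

/-- Up to a small multiple of the norm of `f`, the norm of `f ∘ φ` is determined by the points that
`φ` maps to a smaller polydisc. -/
theorem exists_lintegral_comp_le {φ : ℂ × ℂ → ℂ × ℂ} (hself : MapsTo φ bidisc bidisc)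
    (hholo : DifferentiableOn ℂ φ bidisc) {ε r : ℝ} (hε : 0 < ε) (hr : r < 1)
    (hmin : ∀ z ∈ bidisc, min ‖(φ z).1‖ ‖(φ z).2‖ ≤ 1 - ε)
    (haxes : ∀ z ∈ ball (0 : ℂ) 1, ‖φ (z, 0)‖ ≤ r ∧ ‖φ (0, z)‖ ≤ r) :
    ∃ K ≥ 0, ∀ η > 0, η ≤ ε → ∀ f : BergmanSpace, ∀ b ≥ 0,
      (∀ w, ‖w‖ ≤ 1 - η → ‖zeroExtension f w‖ ≤ b) →
      ∫⁻ z in bidisc, ‖zeroExtension f (φ z)‖ₑ ^ 2 ≤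
        ENNReal.ofReal (K * η * ‖f‖ ^ 2 + b ^ 2 * volume.real bidisc) := by
  have h1r : 0 < 1 - r := by linarith
  set K := 13824 / (ε ^ 2 * (1 - r) ^ 3) with hK
  have hK0 : 0 ≤ K := by positivity
  refine ⟨2 * K, by positivity, fun η hη hηε f b hb hbound => ?_⟩
  -- Nothing is known about `φ` off the bidisc; its extension by zero is globally measurable, as the
  -- preceding estimates require.
  set ψ := bidisc.indicator φ with hψ
  have hψeq : EqOn ψ φ bidisc := fun z hz => indicator_of_mem hz φ
  have hψm : Measurable ψ := by
    classical
    rw [hψ, ← piecewise_eq_indicator]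
    exact hholo.continuousOn.measurable_piecewise continuousOn_const isOpen_bidisc.measurableSet
  have hψd : DifferentiableOn ℂ ψ bidisc := hholo.congr hψeq
  have hψs : MapsTo ψ bidisc bidisc := hself.congr hψeq.symm
  have hax₁ : ∀ z ∈ ball (0 : ℂ) 1, ‖ψ (z, 0)‖ ≤ r := fun z hz => by
    rw [hψeq ⟨hz, mem_ball_self one_pos⟩]; exact (haxes z hz).1
  have hax₂ : ∀ z ∈ ball (0 : ℂ) 1, ‖ψ (0, z)‖ ≤ r := fun z hz => by
    rw [hψeq ⟨mem_ball_self one_pos, hz⟩]; exact (haxes z hz).2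
  have hFm := measurable_zeroExtension f
  have hFd := differentiableOn_zeroExtension f
  set F := zeroExtension f with hF
  set A₂ := bidisc ∩ {z | ‖(ψ z).1‖ ≤ 1 - ε ∧ 1 - η < ‖(ψ z).2‖} with hA₂
  set A₁ := bidisc ∩ {z | ‖(ψ z).2‖ ≤ 1 - ε ∧ 1 - η < ‖(ψ z).1‖} with hA₁
  set B := bidisc ∩ {z | ‖ψ z‖ ≤ 1 - η} with hB
  have hBm : MeasurableSet B :=
    isOpen_bidisc.measurableSet.inter (measurableSet_le (by fun_prop) measurable_const)
  -- Since η ≤ ε, a coordinate of modulus above 1 - η is not the one bounded by 1 - ε, so the other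
  -- one is.
  have hcover : bidisc ⊆ A₁ ∪ A₂ ∪ B := by
    intro z hz
    have hm := hmin z hz
    rw [← hψeq hz, min_le_iff] at hm
    by_cases hzB : ‖ψ z‖ ≤ 1 - η
    · exact Or.inr ⟨hz, hzB⟩
    · left
      rw [not_le, Prod.norm_def, lt_max_iff] at hzB
      by_cases h1 : ‖(ψ z).1‖ ≤ 1 - ε
      · exact Or.inr ⟨hz, h1, hzB.resolve_left (by linarith)⟩
      · exact Or.inl ⟨hz, hm.resolve_left h1, hzB.resolve_right (by linarith [hm.resolve_left h1])⟩
  have h2 : ∫⁻ z in A₂, ‖F (ψ z)‖ₑ ^ 2 ≤ ENNReal.ofReal (K * η) * ‖f‖ₑ ^ 2 := by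
    rw [enorm_sq_eq]
    exact lintegral_comp_near_circle_le (p := fun z => (ψ z).1) (g := fun z => (ψ z).2)
      (by fun_prop) (by fun_prop) hFm (by fun_prop) (fun z hz => (hψs hz).2) hFd hr
      (fun z hz => (norm_snd_le _).trans (hax₁ z hz)) (fun z hz => (norm_snd_le _).trans (hax₂ z hz))
      hε
  -- The roles of the coordinates are exchanged by composing F with the swap, which preserves
  -- volume.
  have h1 : ∫⁻ z in A₁, ‖F (ψ z)‖ₑ ^ 2 ≤ ENNReal.ofReal (K * η) * ‖f‖ₑ ^ 2 := by
    have hswap : ∫⁻ z in bidisc, ‖(F ∘ Prod.swap) z‖ₑ ^ 2 = ‖f‖ₑ ^ 2 := by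
      have h := (Measure.measurePreserving_swap (μ := (volume : Measure ℂ))
        (ν := (volume : Measure ℂ))).setLIntegral_comp_preimage isOpen_bidisc.measurableSet
        (hFm.enorm.pow_const 2)
      rw [preimage_swap_bidisc] at h
      rw [enorm_sq_eq]
      exact h
    rw [← hswap]
    exact lintegral_comp_near_circle_le (p := fun z => (ψ z).2) (g := fun z => (ψ z).1)
      (by fun_prop) (by fun_prop) (hFm.comp measurable_swap) (by fun_prop)
      (fun z hz => (hψs hz).1) (hFd.comp (by unfold Prod.swap; fun_prop) fun z hz => ⟨hz.2, hz.1⟩) hr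
      (fun z hz => (norm_fst_le _).trans (hax₁ z hz)) (fun z hz => (norm_fst_le _).trans (hax₂ z hz))
      hε
  have h3 : ∫⁻ z in B, ‖F (ψ z)‖ₑ ^ 2 ≤ ENNReal.ofReal (b ^ 2 * volume.real bidisc) := by
    calc _ ≤ ∫⁻ _ in B, ENNReal.ofReal (b ^ 2) := by
          refine setLIntegral_mono' hBm fun z hz => ?_
          rw [← ofReal_norm, ← ENNReal.ofReal_pow (norm_nonneg _)]
          have := hbound _ hz.2
          gcongr
      _ ≤ ENNReal.ofReal (b ^ 2) * volume bidisc := by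
          rw [setLIntegral_const]
          gcongr
          exact inter_subset_left
      _ = _ := by
          rw [ENNReal.ofReal_mul (by positivity), ofReal_measureReal volume_bidisc_ne_top]
  calc ∫⁻ z in bidisc, ‖F (φ z)‖ₑ ^ 2 = ∫⁻ z in bidisc, ‖F (ψ z)‖ₑ ^ 2 :=
        setLIntegral_congr_fun isOpen_bidisc.measurableSet fun z hz => by simp only [hψeq hz]
    _ ≤ ∫⁻ z in A₁ ∪ A₂ ∪ B, ‖F (ψ z)‖ₑ ^ 2 := lintegral_mono_set hcover
    _ ≤ (∫⁻ z in A₁, ‖F (ψ z)‖ₑ ^ 2) + (∫⁻ z in A₂, ‖F (ψ z)‖ₑ ^ 2) +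
        ∫⁻ z in B, ‖F (ψ z)‖ₑ ^ 2 :=
        (lintegral_union_le _ _ _).trans (by gcongr; exact lintegral_union_le _ _ _)
    _ ≤ ENNReal.ofReal (K * η) * ‖f‖ₑ ^ 2 + ENNReal.ofReal (K * η) * ‖f‖ₑ ^ 2 +
        ENNReal.ofReal (b ^ 2 * volume.real bidisc) := by gcongr
    _ = _ := by
        rw [← ofReal_norm, ← ENNReal.ofReal_pow (norm_nonneg _),
          ← ENNReal.ofReal_mul (by positivity), ← ENNReal.ofReal_add (by positivity) (by positivity),
          ← ENNReal.ofReal_add (by positivity) (by positivity)]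
        congr 1
        ring

/-- The unit ball of the Bergman space is precompact for uniform convergence on compact
polydiscs. -/
theorem exists_finite_uniform_net {s b : ℝ} (hs : s < 1) (hb : 0 < b) :
    ∃ N : Set BergmanSpace, N.Finite ∧ N ⊆ closedBall 0 1 ∧ ∀ f ∈ closedBall (0 : BergmanSpace) 1,
      ∃ g ∈ N, ∀ w, ‖w‖ ≤ s → ‖zeroExtension (f - g) w‖ ≤ b := by
  obtain ⟨D, hD, hlip⟩ := exists_lipschitz_bound hs
  -- Since ‖f - g‖ ≤ 2, moving by δ changes f - g by at most 2Dδ ≤ b/2; the + 1 covers D = 0.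
  set δ := b / (4 * (D + 1)) with hδ
  have hδ0 : 0 < δ := by positivity
  obtain ⟨t, hts, htf, htc⟩ := (isCompact_closedBall (0 : ℂ × ℂ) s).finite_cover_balls hδ0
  have := htf.fintype
  set E : BergmanSpace → t → ℂ := fun f y => zeroExtension f y with hE
  -- Evaluation at the finitely many centres lands in a bounded set of a finite-dimensional space,
  -- and the Lipschitz bound carries closeness there to the whole polydisc.
  have hEb : TotallyBounded (E '' closedBall 0 1) := by
    refine (isCompact_closedBall (0 : t → ℂ) (π * (1 - s) ^ 2)⁻¹).totallyBounded.subset ?_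
    rintro _ ⟨f, hf, rfl⟩
    have hC : 0 ≤ (π * (1 - s) ^ 2)⁻¹ := by positivity
    rw [mem_closedBall_zero_iff] at hf ⊢
    refine (pi_norm_le_iff_of_nonneg hC).2 fun y => ?_
    refine (norm_zeroExtension_le f hs (mem_closedBall_zero_iff.1 (hts y.2))).trans ?_
    exact mul_le_of_le_one_right hC hf
  obtain ⟨M, hMsub, hMf, hMc⟩ := hEb.exists_subset (dist_mem_uniformity (half_pos hb))
  obtain ⟨N, hNsub, hNf, rfl⟩ := exists_subset_image_finite_and.1 ⟨M, hMsub, hMf, rfl⟩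
  refine ⟨N, hNf, hNsub, fun f hf => ?_⟩
  have hfM := hMc (mem_image_of_mem E hf)
  simp only [mem_iUnion, exists_prop, exists_mem_image] at hfM
  obtain ⟨g, hg, hfg⟩ := hfM
  refine ⟨g, hg, fun w hw => ?_⟩
  obtain ⟨y, hy, hwy⟩ : ∃ y ∈ t, w ∈ ball y δ := by
    simpa using htc (mem_closedBall_zero_iff.2 hw)
  have h1 : ‖zeroExtension (f - g) y‖ ≤ b / 2 := by
    have := (dist_le_pi_dist (E f) (E g) ⟨y, hy⟩).trans hfg.le
    rwa [zeroExtension_sub, Pi.sub_apply, ← dist_eq_norm]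
  have hnorm : ‖f - g‖ ≤ 2 := by
    have h2 := mem_closedBall_zero_iff.1 hf
    have h3 := mem_closedBall_zero_iff.1 (hNsub hg)
    linarith [norm_sub_le f g]
  have h4 := hlip (f - g) y w (mem_closedBall_zero_iff.1 (hts hy)) hw
  have h5 : D * ‖f - g‖ * ‖w - y‖ ≤ b / 2 := by
    rw [mem_ball_iff_norm] at hwy
    calc D * ‖f - g‖ * ‖w - y‖ ≤ (D + 1) * 2 * δ := by gcongr; linarith
      _ = b / 2 := by rw [hδ]; field_simp; norm_num
  have h6 := norm_le_norm_add_norm_sub (zeroExtension (f - g) y) (zeroExtension (f - g) w)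
  rw [norm_sub_rev] at h6
  linarith

theorem isCompactOperator_of_norm_le (T : BergmanSpace →L[ℂ] BergmanSpace) {ε K V : ℝ} (hε : 0 < ε)
    (hK : 0 ≤ K) (hV : 0 ≤ V)
    (hT : ∀ η > 0, η ≤ ε → ∀ f : BergmanSpace, ∀ b ≥ 0,
      (∀ w, ‖w‖ ≤ 1 - η → ‖zeroExtension f w‖ ≤ b) → ‖T f‖ ^ 2 ≤ K * η * ‖f‖ ^ 2 + b ^ 2 * V) :
    IsCompactOperator T := by
  refine (isCompactOperator_iff_isCompact_closure_image_closedBall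
    (T : BergmanSpace →ₗ[ℂ] BergmanSpace) one_pos).2 ?_
  refine TotallyBounded.isCompact_of_isClosed (TotallyBounded.closure ?_) isClosed_closure
  refine Metric.totallyBounded_iff.2 fun e he => ?_
  -- As ‖f - g‖ ≤ 2, these choices make the two error terms at most e²/2 and e²/4, with sum below
  -- e².
  set η := min ε (e ^ 2 / (8 * (K + 1))) with hη
  set b := e / (2 * (V + 1)) with hb
  have hη0 : 0 < η := lt_min hε (by positivity)
  have hb0 : 0 < b := by positivity
  obtain ⟨N, hNf, hNsub, hN⟩ := exists_finite_uniform_net (s := 1 - η) (by linarith) hb0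
  refine ⟨T '' N, hNf.image T, ?_⟩
  rintro _ ⟨f, hf, rfl⟩
  obtain ⟨g, hg, hfg⟩ := hN f hf
  refine mem_biUnion (mem_image_of_mem T hg) ?_
  rw [mem_ball_iff_norm]
  have hnorm : ‖f - g‖ ≤ 2 := by
    have h2 := mem_closedBall_zero_iff.1 hf
    have h3 := mem_closedBall_zero_iff.1 (hNsub hg)
    linarith [norm_sub_le f g]
  have h1 := hT η hη0 (min_le_left _ _) (f - g) b hb0.le hfg
  have h2 : K * η * ‖f - g‖ ^ 2 ≤ e ^ 2 / 2 := by
    calc K * η * ‖f - g‖ ^ 2 ≤ (K + 1) * (e ^ 2 / (8 * (K + 1))) * 2 ^ 2 := by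
          gcongr
          · linarith
          · exact min_le_right _ _
      _ = e ^ 2 / 2 := by field_simp; norm_num
  have h3 : b ^ 2 * V ≤ e ^ 2 / 4 := by
    rw [hb, div_pow, div_mul_eq_mul_div, div_le_div_iff₀ (by positivity) (by positivity)]
    have : V ≤ (V + 1) ^ 2 := by nlinarith
    nlinarith [mul_le_mul_of_nonneg_left this (sq_nonneg e)]
  have h4 : ‖T f - T g‖ ^ 2 < e ^ 2 := by
    rw [← map_sub]
    nlinarith [sq_pos_of_pos he]
  exact (sq_lt_sq₀ (norm_nonneg _) he.le).1 h4

end BergmanSpace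

open BergmanSpace in
theorem mainTheorem4 (φ : ℂ × ℂ → ℂ × ℂ)
    (hself : Set.MapsTo φ bidisc bidisc)
    (hholo : DifferentiableOn ℂ φ bidisc)
    (hcont₁ : ContinuousOn (fun z => (φ z).1) (closure bidisc))
    (hcont₂ : ContinuousOn (fun z => (φ z).2) (closure bidisc))
    (htorus : φ '' closure bidisc ∩ torus = ∅)
    (hbdry : φ '' (closure bidisc \ torus) ∩ frontier bidisc = ∅) :
    CompOpCompactOnBergmanSpace φ hself := by
  have hφ : ContinuousOn φ (closure bidisc) := hcont₁.prodMk hcont₂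
  have hmaps : MapsTo φ (closure bidisc) (closure bidisc) := hself.closure_of_continuousOn hφ
  have hmaps' : MapsTo φ (closure bidisc \ torus) bidisc := fun z hz => by
    by_contra h
    refine (eq_empty_iff_forall_notMem.1 hbdry) (φ z) ⟨mem_image_of_mem _ hz, ?_⟩
    rw [isOpen_bidisc.frontier_eq]
    exact ⟨hmaps hz.1, h⟩
  obtain ⟨ε, hε, hmin⟩ := exists_min_norm_le hφ hmaps htorus
  obtain ⟨r, hr, haxes⟩ := exists_norm_le_on_axes hφ hmaps'
  obtain ⟨K, hK, hest⟩ := exists_lintegral_comp_le hself hholo hε hr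
    (fun z hz => hmin z (subset_closure hz)) haxes
  set V := volume.real bidisc with hV
  have hV0 : 0 ≤ V := measureReal_nonneg
  have heq : ∀ f : BergmanSpace, ∀ z : bidisc,
      zeroExtension f (φ z) = compOp φ hself (f : bidisc → ℂ) z :=
    fun f z => zeroExtension_apply f ⟨φ z, hself z.2⟩
  have hL : ∀ f : BergmanSpace, eLpNorm (compOp φ hself (f : bidisc → ℂ)) 2 bidiscMeasure ^ 2 =
      ∫⁻ z in bidisc, ‖zeroExtension f (φ z)‖ₑ ^ 2 := fun f => by
    rw [← eLpNorm_sq_eq_lintegral (fun z => zeroExtension f (φ z))]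
    congr 2
    exact funext fun z => (heq f z).symm
  -- Taking η = ε and b = C‖f‖ in the norm estimate already gives square integrability of the
  -- composition and boundedness of the operator; small η is needed only for compactness.
  set C := (π * (1 - (1 - ε)) ^ 2)⁻¹ with hC
  have hC0 : 0 ≤ C := by positivity
  have hbd : ∀ f : BergmanSpace, ∀ w, ‖w‖ ≤ 1 - ε → ‖zeroExtension f w‖ ≤ C * ‖f‖ :=
    fun f w hw => norm_zeroExtension_le f (by linarith) hw
  have hholo' : ∀ f : BergmanSpace, HolomorphicOnBidisc (compOp φ hself (f : bidisc → ℂ)) :=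
    fun f => ⟨fun z => zeroExtension f (φ z), (differentiableOn_zeroExtension f).comp hholo hself,
      fun z => (heq f z).symm⟩
  have hmem : ∀ f : BergmanSpace,
      compOp φ hself (f : bidisc → ℂ) ∈ bergmanSubmodule := fun f => by
    refine ⟨hholo' f, (hholo' f).continuous.aestronglyMeasurable, ?_⟩
    have h1 := hest ε hε le_rfl f (C * ‖f‖) (by positivity) (hbd f)
    rw [← hL] at h1
    have h2 := h1.trans_lt ofReal_lt_top
    contrapose! h2
    rw [top_le_iff.1 h2]
    simp
  let T₀ : BergmanSpace →ₗ[ℂ] BergmanSpace :=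
    { toFun := fun f => ⟨compOp φ hself (f : bidisc → ℂ), hmem f⟩
      map_add' := fun _ _ => rfl
      map_smul' := fun _ _ => rfl }
  have hT₀ : ∀ η > 0, η ≤ ε → ∀ f : BergmanSpace, ∀ b ≥ 0,
      (∀ w, ‖w‖ ≤ 1 - η → ‖zeroExtension f w‖ ≤ b) →
        ‖T₀ f‖ ^ 2 ≤ K * η * ‖f‖ ^ 2 + b ^ 2 * V := by
    intro η hη hηε f b hb hfb
    have h1 := hest η hη hηε f b hb hfb
    have h2 : ‖T₀ f‖ₑ = eLpNorm (compOp φ hself (f : bidisc → ℂ)) 2 bidiscMeasure :=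
      Lp.enorm_toLp (T₀ f).2.2
    rw [← hL, ← h2, ← ofReal_norm, ← ENNReal.ofReal_pow (norm_nonneg _)] at h1
    exact (ENNReal.ofReal_le_ofReal_iff (by positivity)).1 h1
  let T : BergmanSpace →L[ℂ] BergmanSpace := T₀.mkContinuous √(K * ε + C ^ 2 * V) fun f => by
    refine (sq_le_sq₀ (norm_nonneg _) (by positivity)).1 ?_
    rw [mul_pow, Real.sq_sqrt (by positivity)]
    refine (hT₀ ε hε le_rfl f (C * ‖f‖) (by positivity) (hbd f)).trans (le_of_eq ?_)
    ring
  exact ⟨T, fun f => rfl, isCompactOperator_of_norm_le T hε hK hV0 hT₀⟩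

end
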